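/- Let $M$ be a connected (non-empty, Hausdorff) smooth manifold of dimension $d$ with a Jacobi structure $(\pi,E)$, that is, a smooth bivector field $\pi$ and a smooth vector field $E$ such that the bracket $\{f,g\}=\pi(df,dg)+f\,E(g)-g\,E(f)$ on $C^\infty(M)$ satisfies the Jacobi identity (equivalently, $[\pi,\pi]=2E\wedge\pi$ and $[E,\pi]=0$, in the corresponding sign convention). A contact resolution of $(M,\pi,E)$ is a triple $(\Sigma,\alpha,\varphi)$ where $\Sigma$ is a (Hausdorff) smooth manifold of the same dimension $d$, $\alpha$ is a contact form on $\Sigma$ (that is, $d=2n+1$ and $\alpha\wedge(d\alpha)^n$ vanishes nowhere), and $\varphi:\Sigma\to M$ is a surjective Jacobi morphism, i.e. a surjective smooth map with $\varphi_*E_\Sigma=E$ and $\varphi_*\pi_\Sigma=\pi$; here $(\pi_\Sigma,E_\Sigma)$ is the Jacobi structure of $\alpha$, in which $E_\Sigma$ is the Reeb field ($\alpha(E_\Sigma)=1$, $d\alpha(E_\Sigma,\cdot)=0$) and $\pi_\Sigma$ is determined by $\alpha(\pi_\Sigma(\beta,\cdot))=0$ and $d\alpha(\cdot,\pi_\Sigma(\beta,\cdot))=\beta-\beta(E_\Sigma)\,\alpha$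 for all covectors $\beta$. The resolution is called separable if $\Sigma$ is second countable. If $(M,\pi,E)$ admits a separable contact resolution, then $(\pi,E)$ is contact on a dense open subset of $M$: there is a dense open set $U\subseteq M$ such that at every point of $U$ one has $d=2n+1$ and $E\wedge\pi^n\neq0$. In particular, the dimension $d$ of $M$ is odd. -/

import Mathlib

open Set Topology
open scoped Manifold ContDiff

noncomputable section

/-- The value on `v` of the exterior product `ξ ∧ B ∧ ⋯ ∧ B` (with `n` factors `B`) of a linear form
`ξ` and an alternating bilinear form `B` on a real vector space `V`.  With `V = TₓM` this is
`α ∧ (dα)ⁿ`; with `V = Tₓ*M` it is `E ∧ πⁿ`, evaluated on `2n + 1` covectors. -/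
def wedgePow {V : Type*} [AddCommGroup V] [Module ℝ V] (ξ : V →ₗ[ℝ] ℝ)
    (B : V →ₗ[ℝ] V →ₗ[ℝ] ℝ) (n : ℕ) (v : Fin (2 * n + 1) → V) : ℝ :=
  ((2 : ℝ) ^ n)⁻¹ * ∑ σ : Equiv.Perm (Fin (2 * n + 1)), ((Equiv.Perm.sign σ : ℤ) : ℝ) *
    (ξ (v (σ 0)) * ∏ i : Fin n,
      B (v (σ ⟨2 * (i : ℕ) + 1, by omega⟩)) (v (σ ⟨2 * (i : ℕ) + 2, by omega⟩)))

/-- The cotangent space of a `d`-dimensional manifold `M` at `x`. -/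
abbrev Cotangent (d : ℕ) {M : Type*} [TopologicalSpace M]
    [ChartedSpace (EuclideanSpace ℝ (Fin d)) M] (x : M) : Type :=
  TangentSpace (𝓡 d) x →L[ℝ] ℝ

/-- Evaluation of covectors at a tangent vector. -/
def evalCovector {d : ℕ} {M : Type*} [TopologicalSpace M]
    [ChartedSpace (EuclideanSpace ℝ (Fin d)) M] {x : M} (v : TangentSpace (𝓡 d) x) :
    Cotangent d x →ₗ[ℝ] ℝ where
  toFun β := β v
  map_add' _ _ := rfl
  map_smul' _ _ := rfl

section Jacobi

variable {d : ℕ} {M : Type*} [TopologicalSpace M] [ChartedSpace (EuclideanSpace ℝ (Fin d)) M]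

/-- The function `y ↦ π(dxⁱ, dxʲ)(y)`, where `x¹, …, xᵈ` are the coordinates of the preferred chart
at `x₀`. -/
def bivectorCoord (π : ∀ x : M, Cotangent d x →ₗ[ℝ] Cotangent d x →ₗ[ℝ] ℝ) (x₀ : M)
    (i j : Fin d) (y : M) : ℝ :=
  π y (mvfderiv (𝓡 d) (fun z : M => extChartAt (𝓡 d) x₀ z i) y)
    (mvfderiv (𝓡 d) (fun z : M => extChartAt (𝓡 d) x₀ z j) y)

/-- The bracket `{f, g} = π(df, dg) + f E(g) - g E(f)`. -/
def jacobiBracket (π : ∀ x : M, Cotangent d x →ₗ[ℝ] Cotangent d x →ₗ[ℝ] ℝ)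
    (E : ∀ x : M, TangentSpace (𝓡 d) x) (f g : M → ℝ) (x : M) : ℝ :=
  π x (mvfderiv (𝓡 d) f x) (mvfderiv (𝓡 d) g x)
    + f x * mvfderiv (𝓡 d) g x (E x) - g x * mvfderiv (𝓡 d) f x (E x)

variable (d M) in
/-- A Jacobi structure on a smooth `d`-dimensional manifold: a smooth bivector field `π` (given by
alternating bilinear forms on the cotangent spaces) and a smooth vector field `E` such that the
bracket `{f, g} = π(df, dg) + f E(g) - g E(f)` on smooth functions satisfies the Jacobi identity
(equivalently, `[π, π] = 2 E ∧ π` and `[E, π] = 0`). -/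
structure JacobiStructure [IsManifold (𝓡 d) ∞ M] where
  biv : ∀ x : M, Cotangent d x →ₗ[ℝ] Cotangent d x →ₗ[ℝ] ℝ
  biv_alt : ∀ (x : M) (β : Cotangent d x), biv x β β = 0
  biv_smooth : ∀ (x₀ : M) (i j : Fin d),
    ContMDiffOn (𝓡 d) 𝓘(ℝ, ℝ) ∞ (bivectorCoord biv x₀ i j)
      (chartAt (EuclideanSpace ℝ (Fin d)) x₀).source
  vec : ∀ x : M, TangentSpace (𝓡 d) x
  vec_smooth : ContMDiff (𝓡 d) (𝓡 d).tangent ∞ (fun x => (⟨x, vec x⟩ : TangentBundle (𝓡 d) M))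
  jacobi : ∀ f g h : M → ℝ, ContMDiff (𝓡 d) 𝓘(ℝ, ℝ) ∞ f → ContMDiff (𝓡 d) 𝓘(ℝ, ℝ) ∞ g →
    ContMDiff (𝓡 d) 𝓘(ℝ, ℝ) ∞ h → ∀ x : M,
      jacobiBracket biv vec f (jacobiBracket biv vec g h) x
        + jacobiBracket biv vec g (jacobiBracket biv vec h f) x
        + jacobiBracket biv vec h (jacobiBracket biv vec f g) x = 0

/-- The Jacobi structure is contact (non-degenerate) at `x`: the dimension is `2n + 1` and
`E ∧ πⁿ` does not vanish at `x`. -/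
def JacobiStructure.IsContactAt [IsManifold (𝓡 d) ∞ M] (J : JacobiStructure d M) (x : M) : Prop :=
  ∃ n : ℕ, d = 2 * n + 1 ∧ ∃ β : Fin (2 * n + 1) → Cotangent d x,
    wedgePow (evalCovector (J.vec x)) (J.biv x) n β ≠ 0

/-- The Jacobi structure is contact on some dense open subset. -/
def JacobiStructure.IsContactOnDenseOpen [IsManifold (𝓡 d) ∞ M] (J : JacobiStructure d M) : Prop :=
  ∃ U : Set M, IsOpen U ∧ Dense U ∧ ∀ x ∈ U, J.IsContactAt x

end Jacobi

section Contact

variable {d : ℕ} {S : Type*} [TopologicalSpace S] [ChartedSpace (EuclideanSpace ℝ (Fin d)) S]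

/-- The expression of a `1`-form in the preferred chart at `x₀` (its pullback by the inverse of the
chart). -/
def formInChart (α : ∀ x : S, Cotangent d x) (x₀ : S) (y : EuclideanSpace ℝ (Fin d)) :
    EuclideanSpace ℝ (Fin d) →L[ℝ] ℝ :=
  ((α ((extChartAt (𝓡 d) x₀).symm y)).comp
    (mfderiv 𝓘(ℝ, EuclideanSpace ℝ (Fin d)) (𝓡 d) (extChartAt (𝓡 d) x₀).symm y)).comp
      (NormedSpace.fromTangentSpace (𝕜 := ℝ) y).symm.toContinuousLinearMap

/-- A `1`-form is smooth if it is so in charts. -/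
def IsSmoothForm (α : ∀ x : S, Cotangent d x) : Prop :=
  ∀ x₀ : S, ContDiffOn ℝ ∞ (formInChart α x₀) (extChartAt (𝓡 d) x₀).target

/-- The exterior derivative of a `1`-form, computed in the preferred chart at `x`:
`dα(v, w) = (D_v α)(w) - (D_w α)(v)`. -/
def formExtDeriv (α : ∀ x : S, Cotangent d x) (x : S) :
    TangentSpace (𝓡 d) x →ₗ[ℝ] TangentSpace (𝓡 d) x →ₗ[ℝ] ℝ :=
  let D : EuclideanSpace ℝ (Fin d) →L[ℝ] EuclideanSpace ℝ (Fin d) →L[ℝ] ℝ :=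
    fderiv ℝ (formInChart α x) (extChartAt (𝓡 d) x x)
  let T : TangentSpace (𝓡 d) x →L[ℝ] EuclideanSpace ℝ (Fin d) :=
    mvfderiv (𝓡 d) (extChartAt (𝓡 d) x) x
  LinearMap.mk₂ ℝ (fun v w => D (T v) (T w) - D (T w) (T v))
    (fun _ _ _ => by simp only [map_add, add_apply]; ring)
    (fun _ _ _ => by
      simp only [map_smul, smul_apply, smul_eq_mul]; ring)
    (fun _ _ _ => by simp only [map_add, add_apply]; ring)
    (fun _ _ _ => by
      simp only [map_smul, smul_apply, smul_eq_mul]; ring)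

/-- A contact form: a smooth `1`-form `α` on a manifold of dimension `2n + 1` such that `α ∧ (dα)ⁿ`
vanishes nowhere. -/
def IsContactForm (α : ∀ x : S, Cotangent d x) : Prop :=
  IsSmoothForm α ∧ ∃ n : ℕ, d = 2 * n + 1 ∧ ∀ x : S,
    ∃ v : Fin (2 * n + 1) → TangentSpace (𝓡 d) x,
      wedgePow (α x : TangentSpace (𝓡 d) x →ₗ[ℝ] ℝ) (formExtDeriv α x) n v ≠ 0

/-- `J` is the Jacobi structure associated with the contact form `α`: its vector field `E` is the
Reeb field, `α(E) = 1` and `dα(E, ·) = 0`, and its bivector field `π` is determined by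
`α(π(β, ·)) = 0` and `dα(·, π(β, ·)) = β - β(E) α` for every covector `β`.  Here the vector
`π(β, ·)` is the `u` with `γ(u) = π(β, γ)` for all `γ`. -/
def JacobiStructure.IsOfContactForm [IsManifold (𝓡 d) ∞ S] (J : JacobiStructure d S)
    (α : ∀ x : S, Cotangent d x) : Prop :=
  ∀ x : S, α x (J.vec x) = 1 ∧ (∀ w, formExtDeriv α x (J.vec x) w = 0) ∧
    ∀ β : Cotangent d x, ∃ u : TangentSpace (𝓡 d) x,
      (∀ γ : Cotangent d x, γ u = J.biv x β γ) ∧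
        α x u = 0 ∧ ∀ w, formExtDeriv α x w u = β w - β (J.vec x) * α x w

variable {M : Type*} [TopologicalSpace M] [ChartedSpace (EuclideanSpace ℝ (Fin d)) M]

/-- A Jacobi morphism: a smooth map `φ` with `φ_* E = E'` and `φ_* π = π'`. -/
structure IsJacobiMorphism [IsManifold (𝓡 d) ∞ S] [IsManifold (𝓡 d) ∞ M]
    (JS : JacobiStructure d S) (JM : JacobiStructure d M) (φ : S → M) : Prop where
  smooth : ContMDiff (𝓡 d) (𝓡 d) ∞ φ
  map_vec : ∀ s : S, mfderiv (𝓡 d) (𝓡 d) φ s (JS.vec s) = JM.vec (φ s)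
  map_biv : ∀ (s : S) (β γ : Cotangent d (φ s)),
    JS.biv s (β.comp (mfderiv (𝓡 d) (𝓡 d) φ s)) (γ.comp (mfderiv (𝓡 d) (𝓡 d) φ s))
      = JM.biv (φ s) β γ

variable (S) in
/-- A contact resolution of a `d`-dimensional Jacobi manifold `(M, π, E)`, with total space a
`d`-dimensional manifold `S`: a contact form `α` on `S` and a surjective Jacobi morphism from `S`,
with the Jacobi structure of `α`, to `M`. -/
structure ContactResolution [IsManifold (𝓡 d) ∞ S] [IsManifold (𝓡 d) ∞ M]
    (JM : JacobiStructure d M) where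
  form : ∀ x : S, Cotangent d x
  isContact : IsContactForm form
  jac : JacobiStructure d S
  jac_eq : jac.IsOfContactForm form
  toFun : S → M
  morphism : IsJacobiMorphism jac JM toFun
  surj : Function.Surjective toFun

end Contact

end

open Filter MeasureTheory

/-! The contact condition passes from Σ to M at every `φ s` with `dφ` bijective at `s`. On Σ the map
`contactFlat` turns `E` into `α` and `π` into `dα`, so `E ∧ πⁿ` on the flats of some vectors is `α ∧
(dα)ⁿ` on these vectors; inverting `dφ` carries the flats to covectors on M
(`IsJacobiMorphism.isContactAt`). The set of such values is open by the inverse function theorem and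
dense by the equidimensional case of Sard's theorem together with surjectivity. Oddness of `d` is
part of the contact form. -/

/-- `wedgePow` is natural: it only depends on the values of the forms on the given vectors. -/
theorem wedgePow_congr {V W : Type*} [AddCommGroup V] [Module ℝ V] [AddCommGroup W] [Module ℝ W]
    {ξ : V →ₗ[ℝ] ℝ} {B : V →ₗ[ℝ] V →ₗ[ℝ] ℝ} {η : W →ₗ[ℝ] ℝ} {C : W →ₗ[ℝ] W →ₗ[ℝ] ℝ} {n : ℕ}
    {v : Fin (2 * n + 1) → V} {w : Fin (2 * n + 1) → W} (h₁ : ∀ i, ξ (v i) = η (w i))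
    (h₂ : ∀ i j, B (v i) (v j) = C (w i) (w j)) :
    wedgePow ξ B n v = wedgePow η C n w := by
  simp only [wedgePow, h₁, h₂]

/-! ### Linear algebra of a contact form at a point -/

section ContactPoint

variable {d : ℕ} {S : Type*} [TopologicalSpace S] [ChartedSpace (EuclideanSpace ℝ (Fin d)) S]

theorem formExtDeriv_swap (α : ∀ x : S, Cotangent d x) (x : S) (v w : TangentSpace (𝓡 d) x) :
    formExtDeriv α x v w = -formExtDeriv α x w v := by
  simp [formExtDeriv]

instance TangentSpace.finiteDimensional_euclidean (x : S) :
    FiniteDimensional ℝ (TangentSpace (𝓡 d) x) :=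
  inferInstanceAs (FiniteDimensional ℝ (EuclideanSpace ℝ (Fin d)))

instance TangentSpace.t2Space_euclidean (x : S) : T2Space (TangentSpace (𝓡 d) x) :=
  inferInstanceAs (T2Space (EuclideanSpace ℝ (Fin d)))

/-- The covector `α(v) α + dα(·, v)` at `x`. -/
noncomputable def contactFlat (α : ∀ x : S, Cotangent d x) (x : S) (v : TangentSpace (𝓡 d) x) :
    Cotangent d x :=
  α x v • α x + LinearMap.toContinuousLinearMap ((formExtDeriv α x).flip v)

theorem contactFlat_apply (α : ∀ x : S, Cotangent d x) (x : S) (v w : TangentSpace (𝓡 d) x) :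
    contactFlat α x v w = α x v * α x w + formExtDeriv α x w v := rfl

variable [IsManifold (𝓡 d) ∞ S] {J : JacobiStructure d S} {α : ∀ x : S, Cotangent d x}

theorem JacobiStructure.IsOfContactForm.contactFlat_vec (h : J.IsOfContactForm α) (x : S)
    (v : TangentSpace (𝓡 d) x) : contactFlat α x v (J.vec x) = α x v := by
  rw [contactFlat_apply, (h x).1, (h x).2.1 v, mul_one, add_zero]

/-- With `u = π(v♭, ·)`, the left side is `w♭(u) = dα(u, w)` since `α(u) = 0`. The equation defining
`u` and `v♭(E) = α(v)` give `dα(w, u) = dα(w, v)`. -/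
theorem JacobiStructure.IsOfContactForm.biv_contactFlat (h : J.IsOfContactForm α) (x : S)
    (v w : TangentSpace (𝓡 d) x) :
    J.biv x (contactFlat α x v) (contactFlat α x w) = formExtDeriv α x v w := by
  obtain ⟨u, hu, hαu, hdu⟩ := (h x).2.2 (contactFlat α x v)
  rw [← hu, contactFlat_apply, hαu, mul_zero, zero_add, formExtDeriv_swap, hdu,
    h.contactFlat_vec, contactFlat_apply, formExtDeriv_swap α x v w]
  ring

/-- The pushforward of the Jacobi structure of a contact form is contact at every value of a Jacobi
morphism at a point where its differential is bijective. -/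
theorem IsJacobiMorphism.isContactAt {M : Type*} [TopologicalSpace M]
    [ChartedSpace (EuclideanSpace ℝ (Fin d)) M] [IsManifold (𝓡 d) ∞ M] {JM : JacobiStructure d M}
    {φ : S → M} (hφ : IsJacobiMorphism J JM φ) (hα : IsContactForm α) (h : J.IsOfContactForm α)
    {s : S} (hs : Function.Bijective (mfderiv (𝓡 d) (𝓡 d) φ s)) :
    JM.IsContactAt (φ s) := by
  obtain ⟨-, n, hd, hn⟩ := hα
  obtain ⟨v, hv⟩ := hn s
  let A : TangentSpace (𝓡 d) s →L[ℝ] TangentSpace (𝓡 d) (φ s) := mfderiv (𝓡 d) (𝓡 d) φ s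
  let e : TangentSpace (𝓡 d) s ≃ₗ[ℝ] TangentSpace (𝓡 d) (φ s) :=
    LinearEquiv.ofBijective (A : TangentSpace (𝓡 d) s →ₗ[ℝ] TangentSpace (𝓡 d) (φ s)) hs
  let B : TangentSpace (𝓡 d) (φ s) →L[ℝ] TangentSpace (𝓡 d) s :=
    LinearMap.toContinuousLinearMap (e.symm : _ →ₗ[ℝ] _)
  have hBA : ∀ u, B (A u) = u := fun u => e.symm_apply_apply u
  have hcomp : ∀ β : Cotangent d s, (β.comp B).comp A = β := fun β => by
    ext u
    exact congrArg β (hBA u)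
  -- These covectors pull back along `dφ` to the flats of the `v i`.
  refine ⟨n, hd, fun i => (contactFlat α s (v i)).comp B, ?_⟩
  rw [wedgePow_congr (η := (α s : TangentSpace (𝓡 d) s →ₗ[ℝ] ℝ)) (C := formExtDeriv α s) (w := v)]
  · exact hv
  · intro i
    change contactFlat α s (v i) (B (JM.vec (φ s))) = α s (v i)
    rw [← hφ.map_vec s, ← h.contactFlat_vec s (v i)]
    exact congrArg _ (hBA _)
  · intro i j
    rw [← hφ.map_biv s, ← h.biv_contactFlat s (v i) (v j)]
    exact congrArg₂ (fun β γ => J.biv s β γ) (hcomp _) (hcomp _)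

end ContactPoint

/-! ### Regular values in equal dimensions -/

section Sard

variable {d : ℕ} {S : Type*} [TopologicalSpace S] [ChartedSpace (EuclideanSpace ℝ (Fin d)) S]
  {M : Type*} [TopologicalSpace M] [ChartedSpace (EuclideanSpace ℝ (Fin d)) M]

/-- The expression of a map in the charts at `s₀` and `m₀`. -/
def mapInCharts (φ : S → M) (s₀ : S) (m₀ : M) :
    EuclideanSpace ℝ (Fin d) → EuclideanSpace ℝ (Fin d) :=
  chartAt (EuclideanSpace ℝ (Fin d)) m₀ ∘ φ ∘ (chartAt (EuclideanSpace ℝ (Fin d)) s₀).symm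

theorem ContinuousLinearMap.bijective_iff_det_ne_zero {E : Type*} [NormedAddCommGroup E]
    [NormedSpace ℝ E] [FiniteDimensional ℝ E] (f : E →L[ℝ] E) :
    Function.Bijective f ↔ f.det ≠ 0 := by
  rw [← isUnit_iff_ne_zero]
  change Function.Bijective (f : E →ₗ[ℝ] E) ↔ IsUnit (LinearMap.det (f : E →ₗ[ℝ] E))
  rw [← LinearMap.isUnit_iff_isUnit_det, Module.End.isUnit_iff]

variable [IsManifold (𝓡 d) ∞ S] [IsManifold (𝓡 d) ∞ M] {φ : S → M}

theorem contDiffAt_mapInCharts (hφ : ContMDiff (𝓡 d) (𝓡 d) ∞ φ) {s₀ : S} {m₀ : M}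
    {y : EuclideanSpace ℝ (Fin d)} (hy : y ∈ (chartAt (EuclideanSpace ℝ (Fin d)) s₀).target)
    (hm : φ ((chartAt (EuclideanSpace ℝ (Fin d)) s₀).symm y) ∈
      (chartAt (EuclideanSpace ℝ (Fin d)) m₀).source) :
    ContDiffAt ℝ ∞ (mapInCharts φ s₀ m₀) y := by
  rw [← contMDiffAt_iff_contDiffAt]
  have h₁ : ContMDiffAt (𝓡 d) (𝓡 d) ∞ (chartAt (EuclideanSpace ℝ (Fin d)) s₀).symm y :=
    contMDiffOn_chart_symm.contMDiffAt ((chartAt _ s₀).open_target.mem_nhds hy)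
  have h₂ : ContMDiffAt (𝓡 d) (𝓡 d) ∞ (chartAt (EuclideanSpace ℝ (Fin d)) m₀)
      (φ ((chartAt (EuclideanSpace ℝ (Fin d)) s₀).symm y)) :=
    contMDiffOn_chart.contMDiffAt ((chartAt _ m₀).open_source.mem_nhds hm)
  exact h₂.comp y ((hφ _).comp y h₁)

/-- Chain rule: the differentials of the charts are bijective. This reduces regularity to a Jacobian
determinant on Euclidean space. -/
theorem bijective_mfderiv_iff_det_mapInCharts (hφ : ContMDiff (𝓡 d) (𝓡 d) ∞ φ) {s₀ : S} {m₀ : M}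
    {y : EuclideanSpace ℝ (Fin d)} (hy : y ∈ (chartAt (EuclideanSpace ℝ (Fin d)) s₀).target)
    (hm : φ ((chartAt (EuclideanSpace ℝ (Fin d)) s₀).symm y) ∈
      (chartAt (EuclideanSpace ℝ (Fin d)) m₀).source) :
    Function.Bijective
        (mfderiv (𝓡 d) (𝓡 d) φ ((chartAt (EuclideanSpace ℝ (Fin d)) s₀).symm y)) ↔
      (fderiv ℝ (mapInCharts φ s₀ m₀) y).det ≠ 0 := by
  have hn : (∞ : WithTop ℕ∞) ≠ 0 := by simp
  have : IsManifold (𝓡 d) 1 S := .of_le (n := ∞) (by simp)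
  have : IsManifold (𝓡 d) 1 M := .of_le (n := ∞) (by simp)
  have hS := mdifferentiable_chart (I := 𝓡 d) s₀
  have hM := mdifferentiable_chart (I := 𝓡 d) m₀
  have hφ' := (hφ.mdifferentiable hn) ((chartAt (EuclideanSpace ℝ (Fin d)) s₀).symm y)
  rw [← ContinuousLinearMap.bijective_iff_det_ne_zero, ← mfderiv_eq_fderiv]
  have key : mfderiv (𝓡 d) (𝓡 d) (mapInCharts φ s₀ m₀) y = _ :=
    (mfderiv_comp (I' := 𝓡 d) y (hM.mdifferentiableAt hm)
      (hφ'.comp y (hS.mdifferentiableAt_symm hy))).trans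
      (congrArg _ (mfderiv_comp (I' := 𝓡 d) y hφ' (hS.mdifferentiableAt_symm hy)))
  have hb₁ := hM.mfderiv_bijective hm
  have hb₂ := hS.symm.mfderiv_bijective (x := y) hy
  refine Iff.trans ?_ (iff_of_eq (congrArg (fun L : EuclideanSpace ℝ (Fin d) →L[ℝ]
    EuclideanSpace ℝ (Fin d) => Function.Bijective L) key.symm))
  exact (Function.Bijective.of_comp_iff _ hb₂).symm.trans
    (Function.Bijective.of_comp_iff' hb₁ _).symm

/-- The image of the set of points where the differential of a smooth map between manifolds of the
same dimension is bijective is open. -/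
theorem isOpen_image_bijective_mfderiv (hφ : ContMDiff (𝓡 d) (𝓡 d) ∞ φ) :
    IsOpen (φ '' {s | Function.Bijective (mfderiv (𝓡 d) (𝓡 d) φ s)}) := by
  rw [isOpen_iff_mem_nhds]
  rintro _ ⟨s, hs, rfl⟩
  set c := chartAt (EuclideanSpace ℝ (Fin d)) s with hc
  set e := chartAt (EuclideanSpace ℝ (Fin d)) (φ s)
  have hsc : s ∈ c.source := mem_chart_source _ s
  have hse : φ s ∈ e.source := mem_chart_source _ (φ s)
  have hcs : c.symm (c s) = s := c.left_inv hsc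
  have hF : ContDiffAt ℝ ∞ (mapInCharts φ s (φ s)) (c s) :=
    contDiffAt_mapInCharts hφ (c.map_source hsc) (by rw [← hc, hcs]; exact hse)
  have hdet : (fderiv ℝ (mapInCharts φ s (φ s)) (c s)).det ≠ 0 := by
    rw [← bijective_mfderiv_iff_det_mapInCharts hφ (c.map_source hsc)
      (by rw [← hc, hcs]; exact hse), ← hc, hcs]
    exact hs
  have hevent : ∀ᶠ t in 𝓝 s, t ∈ c.source ∧ φ t ∈ e.source ∧
      (fderiv ℝ (mapInCharts φ s (φ s)) (c t)).det ≠ 0 := by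
    refine (show ∀ᶠ t in 𝓝 s, t ∈ c.source from c.open_source.mem_nhds hsc).and
      ((hφ.continuous.continuousAt.eventually_mem (e.open_source.mem_nhds hse)).and ?_)
    have hcont : ContinuousAt (fun t => (fderiv ℝ (mapInCharts φ s (φ s)) (c t)).det) s :=
      ContinuousLinearMap.continuous_det.continuousAt.comp
        (ContinuousAt.comp (f := c) (hF.continuousAt_fderiv (by simp)) (c.continuousAt hsc))
    exact hcont.eventually_ne hdet
  have hreg : {s | Function.Bijective (mfderiv (𝓡 d) (𝓡 d) φ s)} ∈ 𝓝 s := by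
    filter_upwards [hevent] with t ⟨ht, hte, htd⟩
    have hct : c.symm (c t) = t := c.left_inv ht
    rw [← bijective_mfderiv_iff_det_mapInCharts hφ (c.map_source ht)
      (by rw [← hc, hct]; exact hte), ← hc, hct] at htd
    exact htd
  have hmapF : map (mapInCharts φ s (φ s)) (𝓝 (c s)) = 𝓝 (mapInCharts φ s (φ s) (c s)) :=
    (hF.hasStrictFDerivAt (by simp)).map_nhds_eq_of_surj (LinearMap.range_eq_top.2
      ((ContinuousLinearMap.bijective_iff_det_ne_zero _).2 hdet).surjective)
  have hval : mapInCharts φ s (φ s) (c s) = e (φ s) := congrArg (fun t => e (φ t)) hcs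
  -- Near `s`, `φ` is its local expression conjugated by charts, so it inherits local openness.
  have hmap : map φ (𝓝 s) = 𝓝 (φ s) := by
    have h₁ : map (e.symm ∘ mapInCharts φ s (φ s) ∘ c) (𝓝 s) = 𝓝 (φ s) := by
      rw [← map_map, ← map_map, c.map_nhds_eq hsc, hmapF, hval,
        e.symm.map_nhds_eq (e.map_source hse), e.left_inv hse]
    rw [← h₁]
    refine map_congr ?_
    filter_upwards [hevent] with t ⟨ht, hte, _⟩
    change φ t = e.symm (e (φ (c.symm (c t))))
    rw [c.left_inv ht, e.left_inv hte]
  rw [← hmap]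
  exact image_mem_map hreg

/-- Sard's theorem for a surjective smooth map between manifolds of the same dimension with second
countable source: the images of the points with bijective differential are dense. -/
theorem dense_image_bijective_mfderiv [SecondCountableTopology S]
    (hφ : ContMDiff (𝓡 d) (𝓡 d) ∞ φ) (hsurj : Function.Surjective φ) :
    Dense (φ '' {s | Function.Bijective (mfderiv (𝓡 d) (𝓡 d) φ s)}) := by
  rw [dense_iff_inter_open]
  rintro O hO ⟨m, hm⟩
  by_contra hempty
  rw [not_nonempty_iff_eq_empty] at hempty
  have hcrit : ∀ s, φ s ∈ O → ¬ Function.Bijective (mfderiv (𝓡 d) (𝓡 d) φ s) := fun s hs hb =>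
    eq_empty_iff_forall_notMem.1 hempty (φ s) ⟨hs, s, hb, rfl⟩
  set e := chartAt (EuclideanSpace ℝ (Fin d)) m
  -- Second countability enters here: countably many null sets will cover the critical values.
  obtain ⟨T, hT, hcover⟩ := TopologicalSpace.countable_cover_nhds
    (fun s : S => chart_source_mem_nhds (EuclideanSpace ℝ (Fin d)) s)
  let A : S → Set (EuclideanSpace ℝ (Fin d)) := fun s =>
    {y ∈ (chartAt (EuclideanSpace ℝ (Fin d)) s).target |
      φ ((chartAt (EuclideanSpace ℝ (Fin d)) s).symm y) ∈ O ∩ e.source}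
  have hnull : ∀ s, volume (mapInCharts φ s m '' A s) = 0 := fun s =>
    addHaar_image_eq_zero_of_det_fderivWithin_eq_zero volume
      (fun y hy => ((contDiffAt_mapInCharts hφ hy.1 hy.2.2).differentiableAt
        (by simp)).hasFDerivAt.hasFDerivWithinAt)
      (fun y hy => by
        by_contra hne
        exact hcrit _ hy.2.1
          ((bijective_mfderiv_iff_det_mapInCharts hφ hy.1 hy.2.2).2 hne))
  -- By surjectivity, every point of `O` is the image of a critical point, so this nonempty open set
  -- will be null.
  have hsub : e '' (O ∩ e.source) ⊆ ⋃ s ∈ T, mapInCharts φ s m '' A s := by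
    rintro _ ⟨x, hx, rfl⟩
    obtain ⟨t, rfl⟩ := hsurj x
    obtain ⟨s, hs, hts⟩ := mem_iUnion₂.1 (hcover ▸ mem_univ t : t ∈ ⋃ s ∈ T, _)
    have hst := (chartAt (EuclideanSpace ℝ (Fin d)) s).left_inv hts
    refine mem_iUnion₂.2 ⟨s, hs, chartAt _ s t, ⟨(chartAt _ s).map_source hts, ?_⟩, ?_⟩
    · rw [hst]; exact hx
    · exact congrArg (fun t => e (φ t)) hst
  have hzero : volume (e '' (O ∩ e.source)) = 0 :=
    measure_mono_null hsub ((measure_biUnion_null_iff hT).2 fun s _ => hnull s)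
  have hopen : IsOpen (e '' (O ∩ e.source)) :=
    e.isOpen_image_of_subset_source (hO.inter e.open_source) inter_subset_right
  exact (hopen.measure_pos volume ⟨e m, m, ⟨hm, mem_chart_source _ m⟩, rfl⟩).ne' hzero

end Sard

theorem mainTheorem7 {d : ℕ}
    {M : Type*} [TopologicalSpace M] [T2Space M] [ConnectedSpace M]
    [ChartedSpace (EuclideanSpace ℝ (Fin d)) M] [IsManifold (𝓡 d) ∞ M]
    (J : JacobiStructure d M)
    {S : Type*} [TopologicalSpace S] [T2Space S] [SecondCountableTopology S]
    [ChartedSpace (EuclideanSpace ℝ (Fin d)) S] [IsManifold (𝓡 d) ∞ S]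
    (R : ContactResolution S J) :
    J.IsContactOnDenseOpen ∧ Odd d := by
  refine ⟨⟨_, isOpen_image_bijective_mfderiv R.morphism.smooth,
    dense_image_bijective_mfderiv R.morphism.smooth R.surj, ?_⟩, ?_⟩
  · rintro _ ⟨s, hs, rfl⟩
    exact R.morphism.isContactAt R.isContact R.jac_eq hs
  · obtain ⟨-, n, hn, -⟩ := R.isContact
    exact ⟨n, hn⟩
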